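/- Let $\mathbb{K}$ be a field of characteristic zero and let $H_{CK}$ be the Connes–Kreimer Hopf algebra over $\mathbb{K}$: its basis is the set of finite rooted forests (up to isomorphism, non-planar, including the empty forest $1$), its product is disjoint union, and its coproduct is the algebra morphism sending a rooted tree $t$ to $\sum_c l_c\otimes u_c$, where $c$ runs over all the admissible cuts of $t$ (including the empty and the total cut), $l_c$ being the lower part (containing the root, or empty for the total cut) and $u_c$ the upper part. Let $S$ be its antipode. For rooted forests $F$ and $G$, put $F\bullet G=\sum_{v} F\bullet_v G$, where $v$ runs over the vertices of $F$ and $F\bullet_v G$ is obtained from the disjoint union of $F$ and $G$ by adding an edge from $v$ to each root of $G$; extend $\bullet$ bilinearly to $H_{CK}$. Let $\delta_1$ be the one-vertex tree and $\delta_n=\delta_{n-1}\bullet\delta_1$ for $n\geq 2$. Then there are coefficients $a_{i_1,\ldots,i_n}\in\mathbb{K}$ such that for all $n\geq 1$, $$S(\delta_n)=\sum_{\substack{(i_1,\ldots,i_n)\in\mathbb{N}^n,\\ 1i_1+\cdots+ni_n=n}} a_{i_1,\ldots,i_n}\,\delta_1^{i_1}\cdots\delta_n^{i_n}.$$ Moreover,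 any such coefficients satisfy the following, for all $n\geq 1$ and all $(i_1,\ldots,i_n)\in\mathbb{N}^n$ with $1i_1+\cdots+ni_n=n$. If $i_n=1$, then $i_1=\cdots=i_{n-1}=0$ and $a_{i_1,\ldots,i_n}=-1$. Otherwise, $i_n=0$ and $$a_{i_1,\ldots,i_n}=\sum_{\substack{2\leq j\leq n-1,\\ i_j\geq 1}}(i_{j-1}+1)\,a_{i_1,\ldots,i_{j-1}+1,\,i_j-1,\ldots,i_{n-1}}-(n-1)\,\epsilon\, a_{i_1-1,i_2,\ldots,i_{n-1}},$$ where $\epsilon=1$ if $i_1\geq 1$, and $\epsilon=0$ (the last term being absent) if $i_1=0$. -/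

import Mathlib

open scoped TensorProduct

/-! ## Rooted trees and rooted forests -/

/-- Finite multisets form a quotient of a polynomial functor: a multiset of elements of `α` is
represented by its cardinality `n` and a family `Fin n → α`. -/
noncomputable instance Multiset.instQPF : QPF Multiset.{0} where
  P := ⟨ℕ, Fin⟩
  abs p := (List.ofFn p.2 : Multiset _)
  repr s := ⟨s.toList.length, s.toList.get⟩
  abs_repr s := by
    rw [List.ofFn_get, Multiset.coe_toList]
  abs_map f p := by
    obtain ⟨n, g⟩ := p
    simp [PFunctor.map, List.map_ofFn]

/-- Finite rooted (non-planar) trees up to isomorphism: the least fixed point of the finite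
multiset functor, that is, a rooted tree is the finite multiset of the rooted trees hanging
from its root. -/
def RTree : Type := QPF.Fix Multiset.{0}

/-- Finite rooted forests up to isomorphism: finite multisets of rooted trees. The empty forest is
`0`, and disjoint union is `+`. -/
abbrev RForest : Type := Multiset RTree

namespace RTree

noncomputable section

/-- The tree with one root, on which all the trees of the forest `F` are grafted. -/
def node (F : RForest) : RTree := QPF.Fix.mk F

/-- The forest obtained from a tree by deleting its root. -/
def children (t : RTree) : RForest := QPF.Fix.dest t

@[simp] theorem children_node (F : RForest) : (node F).children = F := QPF.Fix.dest_mk F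

@[simp] theorem node_children (t : RTree) : node t.children = t := QPF.Fix.mk_dest t

theorem ind {p : RTree → Prop} (h : ∀ F : RForest, (∀ t ∈ F, p t) → p (node F)) (t : RTree) :
    p t := by
  refine QPF.Fix.ind p (fun F hF => h F ?_) t
  obtain ⟨u, hu, hp⟩ := (QPF.liftp_iff' p F).1 hF
  intro s hs
  rw [← hu] at hs
  change s ∈ (List.ofFn u.2 : Multiset RTree) at hs
  obtain ⟨i, rfl⟩ := (List.mem_ofFn' _ _).1 (Multiset.mem_coe.1 hs)
  exact hp i

instance : WellFoundedRelation RTree where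
  rel s t := s ∈ t.children
  wf := ⟨ind fun F ih => ⟨_, fun s hs => ih s (by simpa using hs)⟩⟩

/-- The one-vertex tree. -/
def dot : RTree := node 0

/-- The admissible cuts of a tree `t`: the multiset of all the pairs `(l, u)`, where `l` is the
lower part (either empty, or a tree with the same root as `t`) and `u` the upper part of `t`. Either
all of `t` is in the upper part, or the root is in the lower part and one chooses a cut of each of
the trees hanging from the root. -/
def cuts (t : RTree) : Multiset (RForest × RForest) :=
  (0, {t}) ::ₘ
    ((t.children.attach.map fun s => cuts s.1).Sections.map Multiset.sum).map
      fun p => ({node p.1}, p.2)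
termination_by t
decreasing_by exact s.2

open Classical in
/-- The multiset of the trees obtained from the tree `t` by choosing a vertex `v` of `t` and adding
an edge from `v` to every root of the forest `G`; there is one term for each vertex `v`, which is
either the root of `t`, or a vertex of one of the trees hanging from it. -/
def graftings (G : RForest) (t : RTree) : Multiset RTree :=
  node (t.children + G) ::ₘ
    t.children.attach.bind fun s =>
      (graftings G s.1).map fun s' => node (s' ::ₘ t.children.erase s.1)
termination_by t
decreasing_by exact s.2

theorem cuts_node (F : RForest) :
    (node F).cuts = (0, {node F}) ::ₘ
      ((F.map cuts).Sections.map Multiset.sum).map fun p => ({node p.1}, p.2) := by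
  rw [cuts, children_node, Multiset.attach_map_val' F cuts]

end

end RTree

open Classical in
/-- The multiset of the forests `F •_v G`, where `v` runs over the vertices of the forest `F`:
`F •_v G` is obtained from `F` and `G` by adding an edge from `v` to every root of `G`. -/
noncomputable def RForest.graftings (F G : RForest) : Multiset RForest :=
  F.bind fun t => (t.graftings G).map fun t' => t' ::ₘ F.erase t

theorem RTree.graftings_node (F G : RForest) :
    (RTree.node F).graftings G = RTree.node (F + G) ::ₘ (F.graftings G).map RTree.node := by
  classical
  rw [RTree.graftings, RTree.children_node, RForest.graftings, Multiset.map_bind]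
  congr 1
  rw [Multiset.attach_bind_coe F fun s =>
    (s.graftings G).map fun s' => RTree.node (s' ::ₘ F.erase s)]
  refine Multiset.bind_congr fun t _ => ?_
  rw [Multiset.map_map]
  simp only [Function.comp_def]

/-! ## The Connes-Kreimer Hopf algebra -/

/-- The vector space with basis the set of rooted forests, with the product induced by disjoint
union of forests. It carries the Hopf algebra structure defined below, not the one of a monoid
algebra. -/
def ConnesKreimer (K : Type*) [CommRing K] : Type _ := AddMonoidAlgebra K RForest

namespace ConnesKreimer

noncomputable section

variable (K : Type*) [CommRing K]

instance : CommRing (ConnesKreimer K) := inferInstanceAs (CommRing (AddMonoidAlgebra K RForest))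

instance : Algebra K (ConnesKreimer K) :=
  inferInstanceAs (Algebra K (AddMonoidAlgebra K RForest))

/-- The basis of rooted forests. -/
def forestBasis : Module.Basis RForest K (ConnesKreimer K) :=
  ⟨AddMonoidAlgebra.coeffLinearEquiv K⟩

/-- A rooted forest, as an element of the Connes-Kreimer algebra. -/
def forest (F : RForest) : ConnesKreimer K := forestBasis K F

/-- A rooted tree, as an element of the Connes-Kreimer algebra. -/
def tree (t : RTree) : ConnesKreimer K := forest K {t}

theorem forest_eq_single (F : RForest) :
    forest K F = (AddMonoidAlgebra.single F 1 : AddMonoidAlgebra K RForest) := rfl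

@[simp] theorem forest_zero : forest K 0 = 1 := rfl

theorem forest_add (F G : RForest) : forest K (F + G) = forest K F * forest K G := by
  have := AddMonoidAlgebra.single_mul_single (R := K) (m₁ := F) (m₂ := G) (r₁ := 1) (r₂ := 1)
  rw [mul_one] at this
  exact this.symm

theorem forest_eq_prod (F : RForest) : forest K F = (F.map (tree K)).prod := by
  induction F using Multiset.induction with
  | empty => simp
  | cons t F ih =>
    rw [← Multiset.singleton_add, forest_add, ih, Multiset.singleton_add, Multiset.map_cons,
      Multiset.prod_cons, tree]

variable {K}

/-- The algebra morphism with prescribed values on trees. -/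
def liftTree {A : Type*} [CommRing A] [Algebra K A] (f : RTree → A) : ConnesKreimer K →ₐ[K] A :=
  AddMonoidAlgebra.lift K A RForest
    { toFun := fun F => (F.toAdd.map f).prod
      map_one' := by simp
      map_mul' := fun F G => by simp }

theorem liftTree_forest {A : Type*} [CommRing A] [Algebra K A] (f : RTree → A) (F : RForest) :
    liftTree f (forest K F) = (F.map f).prod := by
  rw [forest_eq_single]
  exact (AddMonoidAlgebra.lift_single _ _ _).trans (one_smul _ _)

@[simp] theorem liftTree_tree {A : Type*} [CommRing A] [Algebra K A] (f : RTree → A) (t : RTree) :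
    liftTree f (tree K t) = f t := by
  simp [tree, liftTree_forest]

theorem algHom_forest {A : Type*} [CommRing A] [Algebra K A] (f : ConnesKreimer K →ₐ[K] A)
    (F : RForest) : f (forest K F) = (F.map fun t => f (tree K t)).prod := by
  rw [forest_eq_prod, map_multiset_prod, Multiset.map_map]; rfl

theorem algHom_ext {A : Type*} [CommRing A] [Algebra K A] {f g : ConnesKreimer K →ₐ[K] A}
    (h : ∀ t, f (tree K t) = g (tree K t)) : f = g := by
  have : f.toLinearMap = g.toLinearMap := (forestBasis K).ext fun F => by
    change f (forest K F) = g (forest K F)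
    simp [algHom_forest, h]
  exact AlgHom.toLinearMap_injective this

variable (K)

/-- The counit: the coefficient of the empty forest. -/
def counitHom : ConnesKreimer K →ₐ[K] K := liftTree fun _ => 0

/-- The coproduct: the algebra morphism that sends a tree to the sum of `l ⊗ u` over its admissible
cuts, with the lower part `l` on the left and the upper part `u` on the right. -/
def comulHom : ConnesKreimer K →ₐ[K] ConnesKreimer K ⊗[K] ConnesKreimer K :=
  liftTree fun t => (t.cuts.map fun p => forest K p.1 ⊗ₜ[K] forest K p.2).sum

/-- The grafting operator, sending a forest `F` to the tree whose root carries the trees of `F`. -/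
def graftRoot : ConnesKreimer K →ₗ[K] ConnesKreimer K :=
  (forestBasis K).constr K fun F => tree K (RTree.node F)

@[simp] theorem graftRoot_forest (F : RForest) :
    graftRoot K (forest K F) = tree K (RTree.node F) := by
  simp [graftRoot, forest]

theorem prod_map_sum_cuts (s : Multiset (Multiset (RForest × RForest))) :
    (s.map fun m => (m.map fun p => forest K p.1 ⊗ₜ[K] forest K p.2).sum).prod =
      ((s.Sections.map Multiset.sum).map fun p => forest K p.1 ⊗ₜ[K] forest K p.2).sum := by
  have h : (fun m : Multiset (RForest × RForest) =>
      (m.map fun p => forest K p.1 ⊗ₜ[K] forest K p.2).prod) =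
      fun m => forest K m.sum.1 ⊗ₜ[K] forest K m.sum.2 := by
    funext m
    induction m using Multiset.induction with
    | empty => simp [Algebra.TensorProduct.one_def]
    | cons p m ih =>
      simp only [Multiset.map_cons, Multiset.prod_cons, Multiset.sum_cons, ih, Prod.fst_add,
        Prod.snd_add, forest_add, Algebra.TensorProduct.tmul_mul_tmul]
  rw [Multiset.map_map]
  change _ = (s.Sections.map fun m => forest K m.sum.1 ⊗ₜ[K] forest K m.sum.2).sum
  rw [← h]
  induction s using Multiset.induction with
  | empty => simp
  | cons a s ih =>
    simp only [Multiset.map_cons, Multiset.prod_cons, ih, Multiset.sections_cons,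
      Multiset.map_bind, Multiset.map_map, Function.comp_def, Multiset.sum_bind,
      Multiset.sum_map_mul_left, Multiset.sum_map_mul_right]

theorem comul_graftRoot (x : ConnesKreimer K) :
    comulHom K (graftRoot K x) =
      1 ⊗ₜ[K] graftRoot K x + (graftRoot K).rTensor (ConnesKreimer K) (comulHom K x) := by
  suffices h : (comulHom K).toLinearMap ∘ₗ graftRoot K =
      TensorProduct.mk K (ConnesKreimer K) (ConnesKreimer K) 1 ∘ₗ graftRoot K +
        (graftRoot K).rTensor (ConnesKreimer K) ∘ₗ (comulHom K).toLinearMap from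
    LinearMap.congr_fun h x
  refine (forestBasis K).ext fun F => ?_
  change comulHom K (graftRoot K (forest K F)) = 1 ⊗ₜ[K] graftRoot K (forest K F) +
    (graftRoot K).rTensor (ConnesKreimer K) (comulHom K (forest K F))
  have h : comulHom K (forest K F) = (((F.map RTree.cuts).Sections.map Multiset.sum).map
      fun p => forest K p.1 ⊗ₜ[K] forest K p.2).sum := by
    rw [← prod_map_sum_cuts, comulHom, liftTree_forest, Multiset.map_map]
    rfl
  rw [h, graftRoot_forest, comulHom, liftTree_tree, RTree.cuts_node, Multiset.map_cons,
    Multiset.sum_cons, map_multiset_sum]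
  simp only [Multiset.map_map]
  congr 2
  refine Multiset.map_congr rfl fun p _ => ?_
  simp [tree]

theorem tree_node (F : RForest) : tree K (RTree.node F) = graftRoot K (forest K F) := by simp

@[simp] theorem counit_graftRoot (x : ConnesKreimer K) : counitHom K (graftRoot K x) = 0 := by
  suffices h : (counitHom K).toLinearMap ∘ₗ graftRoot K = 0 from LinearMap.congr_fun h x
  refine (forestBasis K).ext fun F => ?_
  change counitHom K (graftRoot K (forest K F)) = 0
  rw [graftRoot_forest, counitHom, liftTree_tree]

/-- To compare two algebra morphisms, it is enough to compare them after the grafting operator. -/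
theorem algHom_ext_graftRoot {A : Type*} [CommRing A] [Algebra K A] {f g : ConnesKreimer K →ₐ[K] A}
    (h : ∀ x, f x = g x → f (graftRoot K x) = g (graftRoot K x)) : f = g := by
  refine algHom_ext fun t => ?_
  induction t using RTree.ind with
  | h F ih =>
    rw [tree_node]
    refine h _ ?_
    rw [algHom_forest, algHom_forest]
    exact congrArg _ (Multiset.map_congr rfl ih)

theorem assoc_rTensor (w : ConnesKreimer K ⊗[K] ConnesKreimer K) (b : ConnesKreimer K) :
    Algebra.TensorProduct.assoc K K K (ConnesKreimer K) (ConnesKreimer K) (ConnesKreimer K)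
        ((graftRoot K).rTensor (ConnesKreimer K) w ⊗ₜ[K] b) =
      (graftRoot K).rTensor (ConnesKreimer K ⊗[K] ConnesKreimer K)
        (Algebra.TensorProduct.assoc K K K (ConnesKreimer K) (ConnesKreimer K) (ConnesKreimer K)
          (w ⊗ₜ[K] b)) := by
  induction w using TensorProduct.induction_on with
  | zero => simp
  | tmul x y => simp
  | add x y hx hy => simp only [map_add, TensorProduct.add_tmul, hx, hy]

theorem assoc_comul_rTensor (z : ConnesKreimer K ⊗[K] ConnesKreimer K) :
    Algebra.TensorProduct.assoc K K K (ConnesKreimer K) (ConnesKreimer K) (ConnesKreimer K)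
        (Algebra.TensorProduct.map (comulHom K) (AlgHom.id K (ConnesKreimer K))
          ((graftRoot K).rTensor (ConnesKreimer K) z)) =
      1 ⊗ₜ[K] (graftRoot K).rTensor (ConnesKreimer K) z +
      (graftRoot K).rTensor (ConnesKreimer K ⊗[K] ConnesKreimer K)
        (Algebra.TensorProduct.assoc K K K (ConnesKreimer K) (ConnesKreimer K) (ConnesKreimer K)
          (Algebra.TensorProduct.map (comulHom K) (AlgHom.id K (ConnesKreimer K)) z)) := by
  induction z using TensorProduct.induction_on with
  | zero => simp
  | tmul x y =>
    simp only [LinearMap.rTensor_tmul, Algebra.TensorProduct.map_tmul, comul_graftRoot,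
      TensorProduct.add_tmul, map_add, assoc_rTensor]
    simp
  | add x y hx hy =>
    simp only [map_add, TensorProduct.tmul_add, hx, hy]
    abel

theorem map_rTensor {C : Type*} [CommRing C] [Algebra K C] (f : ConnesKreimer K →ₐ[K] C)
    (z : ConnesKreimer K ⊗[K] ConnesKreimer K) :
    Algebra.TensorProduct.map (AlgHom.id K (ConnesKreimer K)) f
        ((graftRoot K).rTensor (ConnesKreimer K) z) =
      (graftRoot K).rTensor C
        (Algebra.TensorProduct.map (AlgHom.id K (ConnesKreimer K)) f z) := by
  induction z using TensorProduct.induction_on with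
  | zero => simp
  | tmul x y => simp
  | add x y hx hy => simp only [map_add, hx, hy]

theorem coassoc :
    (Algebra.TensorProduct.assoc K K K (ConnesKreimer K) (ConnesKreimer K)
        (ConnesKreimer K)).toAlgHom.comp
      ((Algebra.TensorProduct.map (comulHom K) (.id K (ConnesKreimer K))).comp (comulHom K)) =
    (Algebra.TensorProduct.map (.id K (ConnesKreimer K)) (comulHom K)).comp (comulHom K) := by
  refine algHom_ext_graftRoot K fun x hx => ?_
  simp only [AlgHom.comp_apply] at hx ⊢
  change Algebra.TensorProduct.assoc K K K _ _ _ _ = _ at hx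
  change Algebra.TensorProduct.assoc K K K _ _ _ _ = _
  rw [comul_graftRoot, map_add, map_add, map_add, assoc_comul_rTensor, hx, map_rTensor]
  simp only [Algebra.TensorProduct.map_tmul, map_one, AlgHom.id_apply, comul_graftRoot,
    TensorProduct.tmul_add, Algebra.TensorProduct.one_def, Algebra.TensorProduct.assoc_tmul]
  abel

instance : Bialgebra K (ConnesKreimer K) :=
  Bialgebra.ofAlgHom (comulHom K) (counitHom K) (coassoc K)
    (by
      refine algHom_ext_graftRoot K fun x _ => ?_
      have h (z : ConnesKreimer K ⊗[K] ConnesKreimer K) :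
          Algebra.TensorProduct.map (counitHom K) (AlgHom.id K (ConnesKreimer K))
            ((graftRoot K).rTensor (ConnesKreimer K) z) = 0 := by
        induction z using TensorProduct.induction_on with
        | zero => simp
        | tmul x y => simp
        | add x y hx hy => simp only [map_add, hx, hy, add_zero]
      simp [comul_graftRoot, h])
    (by
      refine algHom_ext_graftRoot K fun x hx => ?_
      simp only [AlgHom.comp_apply] at hx ⊢
      rw [comul_graftRoot, map_add, map_rTensor, hx]
      simp)

/-- The element `(id ⊗ S) (Δ t)` for a tree `t`, where `S` is the antipode. -/
def idTensorAntipode (t : RTree) : ConnesKreimer K ⊗[K] ConnesKreimer K :=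
  let z := (graftRoot K).rTensor (ConnesKreimer K)
    (t.children.attach.map fun s => idTensorAntipode s.1).prod
  z - 1 ⊗ₜ[K] LinearMap.mul' K (ConnesKreimer K) z
termination_by t
decreasing_by exact s.2

/-- The antipode, as an algebra morphism. -/
def antipodeHom : ConnesKreimer K →ₐ[K] ConnesKreimer K :=
  liftTree fun t => - LinearMap.mul' K (ConnesKreimer K) ((graftRoot K).rTensor (ConnesKreimer K)
    (t.children.map (idTensorAntipode K)).prod)

theorem idTensorAntipode_eq (t : RTree) :
    Algebra.TensorProduct.map (AlgHom.id K (ConnesKreimer K)) (antipodeHom K)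
      (comulHom K (tree K t)) = idTensorAntipode K t := by
  induction t using RTree.ind with
  | h F ih =>
    have h : Algebra.TensorProduct.map (AlgHom.id K (ConnesKreimer K)) (antipodeHom K)
        (comulHom K (forest K F)) = (F.map (idTensorAntipode K)).prod := by
      rw [← AlgHom.comp_apply, algHom_forest]
      exact congrArg _ (Multiset.map_congr rfl ih)
    rw [tree_node, comul_graftRoot, map_add, map_rTensor, h, idTensorAntipode,
      RTree.children_node, Multiset.attach_map_val' F (idTensorAntipode K),
      Algebra.TensorProduct.map_tmul, ← tree_node, antipodeHom, liftTree_tree,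
      RTree.children_node, map_one, TensorProduct.tmul_neg]
    abel

theorem antipode_graftRoot (x : ConnesKreimer K) :
    antipodeHom K (graftRoot K x) = - LinearMap.mul' K (ConnesKreimer K)
      ((graftRoot K).rTensor (ConnesKreimer K)
        (Algebra.TensorProduct.map (AlgHom.id K (ConnesKreimer K)) (antipodeHom K)
          (comulHom K x))) := by
  suffices h : (antipodeHom K).toLinearMap ∘ₗ graftRoot K = - (LinearMap.mul' K (ConnesKreimer K) ∘ₗ
      (graftRoot K).rTensor (ConnesKreimer K) ∘ₗ
        (Algebra.TensorProduct.map (AlgHom.id K (ConnesKreimer K)) (antipodeHom K)).toLinearMap ∘ₗ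
          (comulHom K).toLinearMap) from
    LinearMap.congr_fun h x
  refine (forestBasis K).ext fun F => ?_
  change antipodeHom K (graftRoot K (forest K F)) = - LinearMap.mul' K (ConnesKreimer K)
      ((graftRoot K).rTensor (ConnesKreimer K)
        (Algebra.TensorProduct.map (AlgHom.id K (ConnesKreimer K)) (antipodeHom K)
          (comulHom K (forest K F))))
  have h : Algebra.TensorProduct.map (AlgHom.id K (ConnesKreimer K)) (antipodeHom K)
      (comulHom K (forest K F)) = (F.map (idTensorAntipode K)).prod := by
    rw [← AlgHom.comp_apply, algHom_forest]
    exact congrArg _ (Multiset.map_congr rfl fun t _ => idTensorAntipode_eq K t)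
  rw [h, graftRoot_forest, antipodeHom, liftTree_tree, RTree.children_node]

/-- The morphism `a ⊗ b ↦ S(a) b`. -/
def antipodeMul : ConnesKreimer K ⊗[K] ConnesKreimer K →ₐ[K] ConnesKreimer K :=
  (Algebra.TensorProduct.lmul' K).comp
    (Algebra.TensorProduct.map (antipodeHom K) (.id K (ConnesKreimer K)))

theorem antipodeMul_tmul (a b : ConnesKreimer K) :
    antipodeMul K (a ⊗ₜ[K] b) = antipodeHom K a * b := by
  simp [antipodeMul]

/-- The convolution product of the antipode and the identity. -/
def antipodeConvId : ConnesKreimer K →ₐ[K] ConnesKreimer K :=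
  (antipodeMul K).comp (comulHom K)

theorem antipodeMul_aux (w : ConnesKreimer K ⊗[K] ConnesKreimer K) (b : ConnesKreimer K) :
    LinearMap.mul' K (ConnesKreimer K) ((graftRoot K).rTensor (ConnesKreimer K)
        (Algebra.TensorProduct.map (AlgHom.id K (ConnesKreimer K)) (antipodeHom K) w)) * b =
      LinearMap.mul' K (ConnesKreimer K) ((graftRoot K).rTensor (ConnesKreimer K)
        (Algebra.TensorProduct.map (AlgHom.id K (ConnesKreimer K)) (antipodeMul K)
          (Algebra.TensorProduct.assoc K K K (ConnesKreimer K) (ConnesKreimer K) (ConnesKreimer K)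
            (w ⊗ₜ[K] b)))) := by
  induction w using TensorProduct.induction_on with
  | zero => simp
  | tmul x y => simp [mul_assoc, antipodeMul_tmul]
  | add x y hx hy => simp only [map_add, TensorProduct.add_tmul, add_mul, hx, hy]

theorem antipodeMul_rTensor (z : ConnesKreimer K ⊗[K] ConnesKreimer K) :
    antipodeMul K ((graftRoot K).rTensor (ConnesKreimer K) z) =
      - LinearMap.mul' K (ConnesKreimer K) ((graftRoot K).rTensor (ConnesKreimer K)
        (Algebra.TensorProduct.map (AlgHom.id K (ConnesKreimer K)) (antipodeMul K)
          (Algebra.TensorProduct.assoc K K K (ConnesKreimer K) (ConnesKreimer K) (ConnesKreimer K)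
            (Algebra.TensorProduct.map (comulHom K) (AlgHom.id K (ConnesKreimer K)) z)))) := by
  induction z using TensorProduct.induction_on with
  | zero => simp
  | tmul x y =>
    rw [LinearMap.rTensor_tmul, antipodeMul_tmul, antipode_graftRoot,
      Algebra.TensorProduct.map_tmul, AlgHom.id_apply, ← antipodeMul_aux, neg_mul]
  | add x y hx hy =>
    simp only [map_add, hx, hy]
    abel

theorem antipodeConvId_graftRoot_aux {x : ConnesKreimer K}
    (hx : Algebra.TensorProduct.map (AlgHom.id K (ConnesKreimer K)) (antipodeConvId K)
      (comulHom K x) = x ⊗ₜ[K] 1) : antipodeConvId K (graftRoot K x) = 0 := by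
  have hc := DFunLike.congr_fun (coassoc K) x
  simp only [AlgHom.comp_apply] at hc
  change Algebra.TensorProduct.assoc K K K _ _ _ _ = _ at hc
  have hm (z : ConnesKreimer K ⊗[K] ConnesKreimer K) :
      Algebra.TensorProduct.map (AlgHom.id K (ConnesKreimer K)) (antipodeMul K)
        (Algebra.TensorProduct.map (AlgHom.id K (ConnesKreimer K)) (comulHom K) z) =
      Algebra.TensorProduct.map (AlgHom.id K (ConnesKreimer K)) (antipodeConvId K) z := by
    induction z using TensorProduct.induction_on with
    | zero => simp
    | tmul x y => simp [antipodeConvId]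
    | add x y hx hy => simp only [map_add, hx, hy]
  rw [antipodeConvId, AlgHom.comp_apply, comul_graftRoot, map_add, antipodeMul_rTensor, hc, hm,
    hx, antipodeMul_tmul]
  simp

theorem map_antipodeConvId (x : ConnesKreimer K) :
    Algebra.TensorProduct.map (AlgHom.id K (ConnesKreimer K)) (antipodeConvId K)
      (comulHom K x) = x ⊗ₜ[K] 1 := by
  suffices h : (Algebra.TensorProduct.map (AlgHom.id K (ConnesKreimer K)) (antipodeConvId K)).comp
      (comulHom K) = Algebra.TensorProduct.includeLeft from DFunLike.congr_fun h x
  refine algHom_ext_graftRoot K fun x hx => ?_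
  simp only [AlgHom.comp_apply, Algebra.TensorProduct.includeLeft_apply] at hx ⊢
  rw [comul_graftRoot, map_add, map_rTensor, hx, Algebra.TensorProduct.map_tmul,
    antipodeConvId_graftRoot_aux K hx]
  simp

theorem antipode_left :
    antipodeConvId K = (Algebra.ofId K (ConnesKreimer K)).comp (counitHom K) := by
  refine algHom_ext_graftRoot K fun x _ => ?_
  rw [antipodeConvId_graftRoot_aux K (map_antipodeConvId K x), AlgHom.comp_apply,
    counit_graftRoot, map_zero]

theorem antipode_right :
    ((Algebra.TensorProduct.lmul' K).comp
      (Algebra.TensorProduct.map (.id K (ConnesKreimer K)) (antipodeHom K))).comp (comulHom K) =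
    (Algebra.ofId K (ConnesKreimer K)).comp (counitHom K) := by
  refine algHom_ext_graftRoot K fun x _ => ?_
  rw [AlgHom.comp_apply, AlgHom.comp_apply, AlgHom.comp_apply, counit_graftRoot, comul_graftRoot,
    map_add, map_rTensor, Algebra.TensorProduct.map_tmul, antipode_graftRoot, map_add,
    Algebra.TensorProduct.lmul'_apply_tmul, map_one, one_mul, map_zero]
  exact neg_add_cancel _

/-- The Connes-Kreimer Hopf algebra. -/
instance : HopfAlgebra K (ConnesKreimer K) where
  antipode := (antipodeHom K).toLinearMap
  mul_antipode_rTensor_comul := congrArg AlgHom.toLinearMap (antipode_left K)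
  mul_antipode_lTensor_comul := congrArg AlgHom.toLinearMap (antipode_right K)

/-- The preLie product of the Connes-Kreimer algebra: `F • G` is the sum of the forests `F •_v G`
over all the vertices `v` of `F`. -/
def preLie : ConnesKreimer K →ₗ[K] ConnesKreimer K →ₗ[K] ConnesKreimer K :=
  (forestBasis K).constr K fun F => (forestBasis K).constr K fun G =>
    ((F.graftings G).map (forest K)).sum

/-- The generators of the Connes-Moscovici subalgebra: `δ_1` is the one-vertex tree, and
`δ_n = δ_{n-1} • δ_1` for `n ≥ 2`. The value at `n = 0` is not used. -/
def delta : ℕ → ConnesKreimer K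
  | 0 => 0
  | 1 => tree K RTree.dot
  | n + 2 => preLie K (delta (n + 1)) (tree K RTree.dot)

end

end ConnesKreimer

/-! ## Multi-indices -/

/-- The set of the multi-indices `(i_1, …, i_n)` such that `1 i_1 + … + n i_n = n`; the entry
`i_{k+1}` is `i k`, for `k : Fin n`. -/
def weightedIndices (n : ℕ) : Finset (Fin n → ℕ) :=
  (Fintype.piFinset fun _ => Finset.range (n + 1)).filter fun i =>
    ∑ k : Fin n, ((k : ℕ) + 1) * i k = n

theorem mem_weightedIndices {n : ℕ} {i : Fin n → ℕ} :
    i ∈ weightedIndices n ↔ ∑ k : Fin n, ((k : ℕ) + 1) * i k = n := by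
  simp only [weightedIndices, Finset.mem_filter, Fintype.mem_piFinset, Finset.mem_range,
    and_iff_right_iff_imp]
  intro h k
  have h1 : ((k : ℕ) + 1) * i k ≤ n :=
    (Finset.single_le_sum (f := fun k : Fin n => ((k : ℕ) + 1) * i k)
      (fun _ _ => Nat.zero_le _) (Finset.mem_univ k)).trans h.le
  nlinarith [Nat.zero_le ((k : ℕ) * i k)]

/-- The family `a` is a family of coefficients of the antipode of the elements `δ_n`: for all
`n ≥ 1`, `S(δ_n)` is the sum of the `a_{i_1, …, i_n} δ_1 ^ i_1 ⋯ δ_n ^ i_n` over the multi-indices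
such that `1 i_1 + … + n i_n = n`. -/
def IsAntipodeExpansion (K : Type*) [CommRing K] (a : (n : ℕ) → (Fin n → ℕ) → K) : Prop :=
  ∀ n : ℕ, 1 ≤ n → HopfAlgebra.antipode K (ConnesKreimer.delta K n) =
    ∑ i ∈ weightedIndices n, a n i • ∏ k : Fin n, ConnesKreimer.delta K ((k : ℕ) + 1) ^ i k

/-- The position just before the position `j` (used when `j` is not the first position). -/
def predPosition {n : ℕ} (j : Fin n) : Fin n :=
  ⟨(j : ℕ) - 1, lt_of_le_of_lt (Nat.sub_le _ _) j.isLt⟩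

/-- The multi-index obtained from `i` by subtracting one at the position `j` and adding one at the
position just before `j`. -/
def shiftIndex {n : ℕ} (i : Fin n → ℕ) (j : Fin n) : Fin n → ℕ := fun k =>
  if k = j then i k - 1 else if (k : ℕ) + 1 = j then i k + 1 else i k

/-- The multi-index obtained from `i` by subtracting one at the first position. -/
def decrFirst {n : ℕ} (i : Fin n → ℕ) : Fin n → ℕ := fun k =>
  if (k : ℕ) = 0 then i k - 1 else i k

/-! For a fixed `y`, the grafting `x ↦ x • y` is a derivation, determined by its compatibility with
the operator that adds a root. Writing `Δ y = ∑ y₁ ⊗ y₂`, an admissible cut of `x • y` is a cut of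
`x` in which `y` is either grafted on the upper part or cut along with the lower part, so that
`Δ (x • y) = ∑ (x₁ • y₁) ⊗ y₂ x₂ + ∑ x₁ ⊗ (x₂ • y)`. As the antipode is the convolution inverse of
the identity, it follows that `S (x • y) = ∑ S y₂ (S x • y₁)`, and in particular that
`S (x • δ₁) = S x • δ₁ - δ₁ S (x • 1)`. Since `δ_n • 1 = n δ_n`, this gives
`S δ_{n+1} = S δ_n • δ₁ - n δ₁ S δ_n`.

On polynomials in the `δ_n`, the derivation `x ↦ x • δ₁` sends `δ_n` to `δ_{n+1}`, so `S δ_n` is a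
polynomial `P_n` in `δ₁, …, δ_n`, and the recursion on the `P_n` is the announced one on their
coefficients. These coefficients are determined by `S δ_n` because the `δ_n` are algebraically
independent: the corolla with `n` leaves occurs in `δ_{n+1}` with coefficient `1`, and no other
corolla does. -/

section Derivations

variable {K A B : Type*} [CommRing K] [CommRing A] [Algebra K A] [CommRing B] [Algebra K B]

/-- The derivations from `A` to `B`, where `B` is an `A`-module through the algebra morphism `φ`.
In contrast with `Derivation`, no instance of `A`-module on `B` is involved, as `φ` varies. -/
def derivationsAlong (φ : A →ₐ[K] B) : Submodule B (A →ₗ[K] B) where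
  carrier := {f | ∀ x y, f (x * y) = φ x * f y + φ y * f x}
  add_mem' {f g} hf hg x y := by simp only [LinearMap.add_apply, hf x y, hg x y]; ring
  zero_mem' x y := by simp
  smul_mem' b f hf x y := by simp only [LinearMap.smul_apply, hf x y, smul_eq_mul]; ring

namespace derivationsAlong

theorem map_one {φ : A →ₐ[K] B} {f : A →ₗ[K] B} (hf : f ∈ derivationsAlong φ) : f 1 = 0 := by
  simpa using hf 1 1

theorem map_algebraMap {φ : A →ₐ[K] B} {f : A →ₗ[K] B} (hf : f ∈ derivationsAlong φ) (r : K) :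
    f (algebraMap K A r) = 0 := by
  rw [Algebra.algebraMap_eq_smul_one, map_smul, map_one hf, smul_zero]

theorem algHom_comp {f : A →ₗ[K] A} (hf : f ∈ derivationsAlong (.id K A)) (φ : A →ₐ[K] B) :
    φ.toLinearMap ∘ₗ f ∈ derivationsAlong φ := fun x y => by
  simp [hf x y]

theorem comp_algHom {f : B →ₗ[K] B} (hf : f ∈ derivationsAlong (.id K B)) (φ : A →ₐ[K] B) :
    f ∘ₗ φ.toLinearMap ∈ derivationsAlong φ := fun x y => by
  simp [hf (φ x) (φ y)]

theorem commutator {f g : A →ₗ[K] A} (hf : f ∈ derivationsAlong (.id K A))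
    (hg : g ∈ derivationsAlong (.id K A)) : f ∘ₗ g - g ∘ₗ f ∈ derivationsAlong (.id K A) :=
  fun x y => by
    simp only [LinearMap.sub_apply, LinearMap.comp_apply, hf _ _, hg _ _, map_add, AlgHom.id_apply]
    ring

theorem map_mulLeft {f : A →ₗ[K] A} (hf : f ∈ derivationsAlong (.id K A)) (b : B) :
    TensorProduct.map f (.mulLeft K b) ∈ derivationsAlong (.id K (A ⊗[K] B)) := by
  intro z w
  induction z using TensorProduct.induction_on with
  | zero => simp
  | add z z' hz hz' => simp only [add_mul, mul_add, map_add, hz, hz']; ring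
  | tmul x y =>
    induction w using TensorProduct.induction_on with
    | zero => simp
    | add w w' hw hw' => simp only [add_mul, mul_add, map_add, hw, hw']; ring
    | tmul x' y' => simp [hf x x', TensorProduct.add_tmul, mul_left_comm, mul_comm y' y]

theorem lTensor {f : B →ₗ[K] B} (hf : f ∈ derivationsAlong (.id K B)) :
    f.lTensor A ∈ derivationsAlong (.id K (A ⊗[K] B)) := by
  intro z w
  induction z using TensorProduct.induction_on with
  | zero => simp
  | add z z' hz hz' => simp only [add_mul, mul_add, map_add, hz, hz']; ring
  | tmul x y =>
    induction w using TensorProduct.induction_on with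
    | zero => simp
    | add w w' hw hw' => simp only [add_mul, mul_add, map_add, hw, hw']; ring
    | tmul x' y' => simp [hf y y', TensorProduct.tmul_add, mul_comm x]

end derivationsAlong

end Derivations

section Convolution

open Coalgebra HopfAlgebra WithConv

variable {K H : Type*} [CommRing K] [CommRing H] [HopfAlgebra K H]

theorem derivation_convMul_antipode {d : H →ₗ[K] H} (hd : d ∈ derivationsAlong (.id K H)) :
    toConv d * toConv (antipode K) = -(toConv LinearMap.id * toConv (d ∘ₗ antipode K)) := by
  rw [eq_neg_iff_add_eq_zero]
  ext x
  have h : d ((toConv LinearMap.id * toConv (antipode K) : WithConv (H →ₗ[K] H)) x) = 0 := by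
    rw [LinearMap.id_mul_antipode, LinearMap.convOne_apply, derivationsAlong.map_algebraMap hd]
  change (toConv d * toConv (antipode K) : WithConv (H →ₗ[K] H)) x +
    (toConv LinearMap.id * toConv (d ∘ₗ antipode K) : WithConv (H →ₗ[K] H)) x = 0
  rw [(ℛ K x).convMul_apply, map_sum] at h
  rw [(ℛ K x).convMul_apply, (ℛ K x).convMul_apply, ← Finset.sum_add_distrib, ← h]
  refine Finset.sum_congr rfl fun i _ => ?_
  rw [hd, add_comm, mul_comm (toConv d _)]
  rfl

theorem antipode_comp_eq_derivation_comp {f d : H →ₗ[K] H} (hd : d ∈ derivationsAlong (.id K H))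
    (h : toConv d * toConv (antipode K) + toConv LinearMap.id * toConv (antipode K ∘ₗ f) = 0) :
    antipode K ∘ₗ f = d ∘ₗ antipode K := by
  rw [derivation_convMul_antipode hd, neg_add_eq_zero] at h
  have hS := congrArg (toConv (antipode K) * ·) h
  simp only [← mul_assoc, LinearMap.antipode_mul_id, one_mul] at hS
  exact toConv_injective hS.symm

end Convolution

theorem RForest.graftings_add (F G H : RForest) :
    (F + G).graftings H =
      (F.graftings H).map (fun F' => F' + G) + (G.graftings H).map (fun G' => F + G') := by
  classical
  simp only [RForest.graftings, Multiset.add_bind, Multiset.map_bind, Multiset.map_map,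
    Function.comp_def]
  congr 1
  · refine Multiset.bind_congr fun t ht => Multiset.map_congr rfl fun t' _ => ?_
    rw [Multiset.erase_add_left_pos _ ht, Multiset.cons_add]
  · refine Multiset.bind_congr fun t ht => Multiset.map_congr rfl fun t' _ => ?_
    rw [Multiset.erase_add_right_pos _ ht, Multiset.add_cons]

theorem RForest.graftings_singleton (t : RTree) (H : RForest) :
    RForest.graftings {t} H = (t.graftings H).map fun t' => {t'} := by
  classical
  simp [RForest.graftings]

section MvPolynomial

open MvPolynomial

variable {R σ : Type*} [CommRing R]

theorem mkDerivation_eq_sum_pderiv {A : Type*} [AddCommGroup A] [Module R A]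
    [Module (MvPolynomial σ R) A] [IsScalarTower R (MvPolynomial σ R) A] (f : σ → A)
    {p : MvPolynomial σ R} {s : Finset σ} (hs : p.vars ⊆ s) :
    mkDerivation R f p = ∑ k ∈ s, pderiv k p • f k := by
  classical
  let D : Derivation R (MvPolynomial σ R) A :=
    ∑ k ∈ s, (LinearMap.toSpanSingleton _ A (f k)).compDer (pderiv k)
  have hD (q : MvPolynomial σ R) : D q = ∑ k ∈ s, pderiv k q • f k := by
    change Derivation.coeFnAddMonoidHom D q = _
    rw [map_sum, Finset.sum_apply]
    rfl
  rw [← hD]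
  refine derivation_eq_of_forall_mem_vars fun i hi => ?_
  rw [hD, mkDerivation_X, Finset.sum_eq_single_of_mem i (hs hi)]
  · rw [pderiv_X_self, one_smul]
  · intro k _ hk
    rw [pderiv_X_of_ne hk.symm, zero_smul]

theorem isWeightedHomogeneous_mkDerivation {M : Type*} [AddCommMonoid M] {w : σ → M} {d n : M}
    {f : σ → MvPolynomial σ R} (hf : ∀ i, IsWeightedHomogeneous w (f i) (w i + d))
    {p : MvPolynomial σ R} (hp : IsWeightedHomogeneous w p n) :
    IsWeightedHomogeneous w (mkDerivation R f p) (n + d) := by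
  induction hp using IsWeightedHomogeneous.induction_on with
  | zero => simpa using isWeightedHomogeneous_zero R w _
  | add p q _ _ hp hq => simpa using hp.add hq
  | monomial s r hs =>
    rw [mkDerivation_monomial, Finsupp.sum, smul_eq_C_mul]
    refine IsWeightedHomogeneous.C_mul (IsWeightedHomogeneous.sum _ _ _ fun i hi => ?_) r
    have hw := Finsupp.weight_sub_single_add (w := w) (Finsupp.mem_support_iff.1 hi)
    rw [← hs, ← hw, add_assoc]
    exact (isWeightedHomogeneous_monomial w _ _ rfl).mul (hf i)

end MvPolynomial

namespace ConnesKreimer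

open Coalgebra HopfAlgebra

noncomputable section

variable {K : Type*} [CommRing K]

/-! ### The antipode of a grafting -/

theorem preLie_forest (F G : RForest) :
    preLie K (forest K F) (forest K G) = ((F.graftings G).map (forest K)).sum := by
  simp [preLie, forest]

theorem mul_preLie (x y z : ConnesKreimer K) :
    preLie K (x * y) z = x * preLie K y z + y * preLie K x z := by
  suffices h : preLie K (x * y) = .mulLeft K x ∘ₗ preLie K y + .mulLeft K y ∘ₗ preLie K x from
    LinearMap.congr_fun h z
  refine (forestBasis K).ext fun G => ?_
  let R : ConnesKreimer K →ₗ[K] ConnesKreimer K := (preLie K).flip (forest K G)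
  have hR (E : RForest) : R (forest K E) = ((E.graftings G).map (forest K)).sum := preLie_forest E G
  suffices h : (LinearMap.mul K _).compr₂ R =
      (LinearMap.mul K _).compl₂ R + ((LinearMap.mul K _).compl₂ R).flip from
    LinearMap.congr_fun₂ h x y
  refine (forestBasis K).ext fun E => (forestBasis K).ext fun F => ?_
  change R (forest K E * forest K F) =
    forest K E * R (forest K F) + forest K F * R (forest K E)
  simp only [← forest_add, hR, RForest.graftings_add, Multiset.map_add, Multiset.sum_add,
    Multiset.map_map, Function.comp_def]
  simp only [forest_add, Multiset.sum_map_mul_left, Multiset.sum_map_mul_right]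
  ring

theorem preLie_flip_mem_derivationsAlong (y : ConnesKreimer K) :
    (preLie K).flip y ∈ derivationsAlong (.id K (ConnesKreimer K)) := fun a b => mul_preLie a b y

theorem one_preLie (y : ConnesKreimer K) : preLie K 1 y = 0 :=
  derivationsAlong.map_one (preLie_flip_mem_derivationsAlong y)

theorem graftRoot_preLie (x y : ConnesKreimer K) :
    preLie K (graftRoot K x) y = graftRoot K (preLie K x y + y * x) := by
  suffices h : preLie K ∘ₗ graftRoot K =
      (preLie K + (LinearMap.mul K _).flip).compr₂ (graftRoot K) from LinearMap.congr_fun₂ h x y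
  refine (forestBasis K).ext fun F => (forestBasis K).ext fun G => ?_
  change preLie K (graftRoot K (forest K F)) (forest K G) =
    graftRoot K (preLie K (forest K F) (forest K G) + forest K G * forest K F)
  rw [graftRoot_forest, tree, preLie_forest, RForest.graftings_singleton, RTree.graftings_node,
    preLie_forest, map_add, ← forest_add, graftRoot_forest, map_multiset_sum, add_comm G F]
  simp only [Multiset.map_cons, Multiset.sum_cons, Multiset.map_map, Function.comp_def,
    graftRoot_forest]
  exact add_comm _ _

theorem derivationsAlong_ext_graftRoot {A : Type*} [CommRing A] [Algebra K A]
    {φ : ConnesKreimer K →ₐ[K] A} {f g : ConnesKreimer K →ₗ[K] A}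
    (hf : f ∈ derivationsAlong φ) (hg : g ∈ derivationsAlong φ)
    (h : ∀ x, f x = g x → f (graftRoot K x) = g (graftRoot K x)) : f = g := by
  have forest_eq (F : RForest) (hF : ∀ t ∈ F, f (tree K t) = g (tree K t)) :
      f (forest K F) = g (forest K F) := by
    induction F using Multiset.induction with
    | empty => rw [forest_zero, derivationsAlong.map_one hf, derivationsAlong.map_one hg]
    | cons t F ih =>
      have ht : f (forest K {t}) = g (forest K {t}) := hF t (Multiset.mem_cons_self t F)
      rw [← Multiset.singleton_add, forest_add, hf, hg, ht,
        ih fun s hs => hF s (Multiset.mem_cons_of_mem hs)]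
  have tree_eq (t : RTree) : f (tree K t) = g (tree K t) := by
    induction t using RTree.ind with
    | h F ih =>
      rw [tree_node]
      exact h _ (forest_eq F ih)
  exact (forestBasis K).ext fun F => forest_eq F fun t _ => tree_eq t

theorem preLie_preLie_sub (x y z : ConnesKreimer K) :
    preLie K (preLie K x z) y - preLie K (preLie K x y) z =
      preLie K x (preLie K z y) - preLie K x (preLie K y z) := by
  let R := (preLie K).flip
  have hR (y) : R y ∈ derivationsAlong (.id K _) := preLie_flip_mem_derivationsAlong y
  suffices h : R y ∘ₗ R z - R z ∘ₗ R y = R (preLie K z y) - R (preLie K y z) from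
    LinearMap.congr_fun h x
  refine derivationsAlong_ext_graftRoot (derivationsAlong.commutator (hR y) (hR z))
    (sub_mem (hR _) (hR _)) fun x hx => ?_
  change preLie K (preLie K x z) y - preLie K (preLie K x y) z =
    preLie K x (preLie K z y) - preLie K x (preLie K y z) at hx
  change preLie K (preLie K (graftRoot K x) z) y - preLie K (preLie K (graftRoot K x) y) z =
    preLie K (graftRoot K x) (preLie K z y) - preLie K (graftRoot K x) (preLie K y z)
  simp only [graftRoot_preLie, map_add, LinearMap.add_apply, mul_preLie]
  simp only [← map_add, ← map_sub]
  congr 1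
  linear_combination hx

theorem counitHom_preLie (x y : ConnesKreimer K) : counitHom K (preLie K x y) = 0 := by
  suffices h : (counitHom K).toLinearMap ∘ₗ (preLie K).flip y = 0 from LinearMap.congr_fun h x
  refine derivationsAlong_ext_graftRoot
    (derivationsAlong.algHom_comp (preLie_flip_mem_derivationsAlong y) _) (zero_mem _) fun x _ => ?_
  change counitHom K (preLie K (graftRoot K x) y) = 0
  rw [graftRoot_preLie, counit_graftRoot]

/-- For `Δ y = ∑ y₁ ⊗ y₂`, the operator `a ⊗ b ↦ ∑ (a • y₁) ⊗ y₂ b`. In an admissible cut of a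
grafting of `y` on a vertex of the lower part `a`, the cut of `y` splits it into `y₁` and `y₂`. -/
def graftLower {ι : Type*} {y : ConnesKreimer K} (𝓡 : Repr K y ι) :
    ConnesKreimer K ⊗[K] ConnesKreimer K →ₗ[K] ConnesKreimer K ⊗[K] ConnesKreimer K :=
  ∑ i ∈ 𝓡.index, TensorProduct.map ((preLie K).flip (𝓡.left i)) (.mulLeft K (𝓡.right i))

section graftLower

variable {ι : Type*} {y : ConnesKreimer K} (𝓡 : Repr K y ι)

theorem graftLower_tmul (a b : ConnesKreimer K) :
    graftLower 𝓡 (a ⊗ₜ[K] b) =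
      ∑ i ∈ 𝓡.index, preLie K a (𝓡.left i) ⊗ₜ[K] (𝓡.right i * b) := by
  simp [graftLower, LinearMap.sum_apply]

theorem graftLower_mem_derivationsAlong : graftLower 𝓡 ∈ derivationsAlong (.id K _) :=
  sum_mem fun _ _ => derivationsAlong.map_mulLeft (preLie_flip_mem_derivationsAlong _) _

theorem graftLower_rTensor_graftRoot (z : ConnesKreimer K ⊗[K] ConnesKreimer K) :
    graftLower 𝓡 ((graftRoot K).rTensor _ z) =
      (graftRoot K).rTensor _ (graftLower 𝓡 z + comulHom K y * z) := by
  have hy : comulHom K y = ∑ i ∈ 𝓡.index, 𝓡.left i ⊗ₜ[K] 𝓡.right i := 𝓡.eq.symm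
  induction z using TensorProduct.induction_on with
  | zero => simp
  | add z z' hz hz' => simp only [map_add, mul_add, hz, hz']; abel
  | tmul a b =>
    simp [graftLower_tmul, hy, graftRoot_preLie, TensorProduct.add_tmul, Finset.sum_mul,
      Finset.sum_add_distrib]

theorem comulHom_preLie (x : ConnesKreimer K) :
    comulHom K (preLie K x y) =
      graftLower 𝓡 (comulHom K x) + ((preLie K).flip y).lTensor _ (comulHom K x) := by
  let R := (preLie K).flip y
  have hR : R ∈ derivationsAlong (.id K _) := preLie_flip_mem_derivationsAlong y
  suffices h : (comulHom K).toLinearMap ∘ₗ R =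
      (graftLower 𝓡 + R.lTensor _) ∘ₗ (comulHom K).toLinearMap from LinearMap.congr_fun h x
  refine derivationsAlong_ext_graftRoot (derivationsAlong.algHom_comp hR _)
    (derivationsAlong.comp_algHom
      (add_mem (graftLower_mem_derivationsAlong 𝓡) (derivationsAlong.lTensor hR)) _) fun x hx => ?_
  change comulHom K (preLie K x y) = graftLower 𝓡 (comulHom K x) + R.lTensor _ (comulHom K x) at hx
  change comulHom K (preLie K (graftRoot K x) y) =
    graftLower 𝓡 (comulHom K (graftRoot K x)) + R.lTensor _ (comulHom K (graftRoot K x))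
  have lower_one : graftLower 𝓡 (1 ⊗ₜ[K] graftRoot K x) = 0 := by
    simp [graftLower_tmul, one_preLie]
  have upper_comm : R.lTensor _ ((graftRoot K).rTensor _ (comulHom K x)) =
      (graftRoot K).rTensor _ (R.lTensor _ (comulHom K x)) := by
    rw [← LinearMap.comp_apply, ← LinearMap.comp_apply, LinearMap.lTensor_comp_rTensor,
      LinearMap.rTensor_comp_lTensor]
  rw [graftRoot_preLie, comul_graftRoot, comul_graftRoot, map_add (comulHom K), map_mul, hx,
    map_add (graftLower 𝓡), lower_one, graftLower_rTensor_graftRoot, map_add (R.lTensor _),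
    upper_comm, LinearMap.lTensor_tmul, LinearMap.flip_apply, graftRoot_preLie]
  simp only [map_add]
  abel

theorem mul_antipode_lTensor_graftLower (z : ConnesKreimer K ⊗[K] ConnesKreimer K) :
    LinearMap.mul' K _ ((antipode K).lTensor _ (graftLower 𝓡 z)) = LinearMap.mul' K _
      (TensorProduct.map (∑ i ∈ 𝓡.index, antipode K (𝓡.right i) • (preLie K).flip (𝓡.left i))
        (antipode K) z) := by
  induction z using TensorProduct.induction_on with
  | zero => simp
  | add z z' hz hz' => simp only [map_add, hz, hz']
  | tmul a b =>
    simp [graftLower_tmul, LinearMap.sum_apply, Finset.sum_mul, antipode_mul_distrib,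
      mul_left_comm, mul_assoc]

theorem antipode_preLie (x : ConnesKreimer K) :
    antipode K (preLie K x y) =
      ∑ i ∈ 𝓡.index, antipode K (𝓡.right i) * preLie K (antipode K x) (𝓡.left i) := by
  let d := ∑ i ∈ 𝓡.index, antipode K (𝓡.right i) • (preLie K).flip (𝓡.left i)
  have hd : d ∈ derivationsAlong (.id K _) := sum_mem fun i _ =>
    Submodule.smul_mem _ _ (preLie_flip_mem_derivationsAlong _)
  suffices h : antipode K ∘ₗ (preLie K).flip y = d ∘ₗ antipode K by
    simpa [d, LinearMap.sum_apply] using LinearMap.congr_fun h x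
  refine antipode_comp_eq_derivation_comp hd ?_
  ext x
  have hx := mul_antipode_lTensor_comul_apply (R := K) (preLie K x y)
  change LinearMap.mul' K _ ((antipode K).lTensor _ (comulHom K (preLie K x y))) =
    algebraMap K _ (counitHom K (preLie K x y)) at hx
  rw [counitHom_preLie, map_zero, comulHom_preLie 𝓡, map_add, map_add,
    mul_antipode_lTensor_graftLower, ← LinearMap.comp_apply (LinearMap.lTensor _ _),
    ← LinearMap.lTensor_comp] at hx
  exact hx

end graftLower

theorem graftRoot_one : graftRoot K 1 = tree K RTree.dot := by
  rw [← forest_zero K, graftRoot_forest, RTree.dot]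

theorem counitHom_dot : counitHom K (tree K RTree.dot) = 0 := by
  rw [← graftRoot_one, counit_graftRoot]

theorem antipode_dot : antipode K (tree K RTree.dot) = -tree K RTree.dot := by
  change antipodeHom K _ = _
  simpa [Algebra.TensorProduct.one_def, graftRoot_one] using antipode_graftRoot K 1

theorem dot_preLie_one : preLie K (tree K RTree.dot) 1 = tree K RTree.dot := by
  rw [← graftRoot_one, graftRoot_preLie, one_preLie, zero_add, one_mul]

theorem antipode_preLie_one (x : ConnesKreimer K) :
    antipode K (preLie K x 1) = preLie K (antipode K x) 1 := by
  let 𝓡 : Repr K (1 : ConnesKreimer K) Unit :=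
    ⟨Finset.univ, fun _ => 1, fun _ => 1, by
      simp [Bialgebra.comul_one, Algebra.TensorProduct.one_def]⟩
  simpa [𝓡] using antipode_preLie 𝓡 x

theorem antipode_preLie_dot (x : ConnesKreimer K) :
    antipode K (preLie K x (tree K RTree.dot)) =
      preLie K (antipode K x) (tree K RTree.dot) -
        tree K RTree.dot * antipode K (preLie K x 1) := by
  have hΔ : comulHom K (tree K RTree.dot) =
      1 ⊗ₜ[K] tree K RTree.dot + tree K RTree.dot ⊗ₜ[K] 1 := by
    simpa [Algebra.TensorProduct.one_def, graftRoot_one] using comul_graftRoot K 1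
  let 𝓡 : Repr K (tree K RTree.dot) (Fin 2) :=
    ⟨Finset.univ, ![1, tree K RTree.dot], ![tree K RTree.dot, 1], by
      simpa using! hΔ.symm⟩
  have h := antipode_preLie 𝓡 x
  simp only [𝓡, Fin.sum_univ_two, Matrix.cons_val_zero, Matrix.cons_val_one, antipode_one,
    antipode_dot] at h
  rw [h, antipode_preLie_one]
  ring

theorem preLie_dot_preLie_one (x : ConnesKreimer K) :
    preLie K (preLie K x (tree K RTree.dot)) 1 =
      preLie K (preLie K x 1) (tree K RTree.dot) + preLie K x (tree K RTree.dot) := by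
  have h := preLie_preLie_sub x 1 (tree K RTree.dot)
  rwa [dot_preLie_one, one_preLie, map_zero, sub_zero, sub_eq_iff_eq_add'] at h

theorem delta_add_two (n : ℕ) :
    delta K (n + 2) = preLie K (delta K (n + 1)) (tree K RTree.dot) := rfl

theorem delta_preLie_one (n : ℕ) : preLie K (delta K n) 1 = n • delta K n := by
  match n with
  | 0 => simp [delta]
  | 1 => simp [delta, dot_preLie_one]
  | n + 2 =>
    rw [delta_add_two, preLie_dot_preLie_one, delta_preLie_one (n + 1), map_nsmul,
      LinearMap.smul_apply, ← succ_nsmul]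

theorem antipode_delta_add_two (n : ℕ) :
    antipode K (delta K (n + 2)) =
      preLie K (antipode K (delta K (n + 1))) (tree K RTree.dot) -
        (n + 1) • (tree K RTree.dot * antipode K (delta K (n + 1))) := by
  rw [delta_add_two, antipode_preLie_dot, delta_preLie_one, map_nsmul, mul_smul_comm]

/-! ### Algebraic independence of the `δ_n` -/

/-- The algebra morphism whose value on a tree is given by a linear map `L` on the forest of its
children. -/
def liftGraft {A : Type*} [CommRing A] [Algebra K A] (L : ConnesKreimer K →ₗ[K] A) :
    ConnesKreimer K →ₐ[K] A :=
  liftTree fun t => L (forest K t.children)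

theorem liftGraft_graftRoot {A : Type*} [CommRing A] [Algebra K A] (L : ConnesKreimer K →ₗ[K] A)
    (x : ConnesKreimer K) : liftGraft L (graftRoot K x) = L x := by
  suffices h : (liftGraft L).toLinearMap ∘ₗ graftRoot K = L from LinearMap.congr_fun h x
  refine (forestBasis K).ext fun F => ?_
  change liftGraft L (graftRoot K (forest K F)) = L (forest K F)
  rw [graftRoot_forest, liftGraft, liftTree_tree, RTree.children_node]

/-- The algebra morphism that sends the one-vertex tree to `X` and the other trees to `0`. -/
def countDots : ConnesKreimer K →ₐ[K] Polynomial K :=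
  liftGraft (LinearMap.toSpanSingleton K _ Polynomial.X ∘ₗ (counitHom K).toLinearMap)

theorem countDots_graftRoot (x : ConnesKreimer K) :
    countDots (graftRoot K x) = counitHom K x • Polynomial.X :=
  liftGraft_graftRoot _ x

theorem countDots_dot : countDots (tree K RTree.dot) = Polynomial.X := by
  rw [← graftRoot_one, countDots_graftRoot, map_one, one_smul]

theorem countDots_preLie_dot (x : ConnesKreimer K) :
    countDots (preLie K x (tree K RTree.dot)) = 0 := by
  suffices h : countDots.toLinearMap ∘ₗ (preLie K).flip (tree K RTree.dot) = 0 from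
    LinearMap.congr_fun h x
  refine derivationsAlong_ext_graftRoot
    (derivationsAlong.algHom_comp (preLie_flip_mem_derivationsAlong _) _) (zero_mem _) fun x _ => ?_
  change countDots (preLie K (graftRoot K x) (tree K RTree.dot)) = 0
  rw [graftRoot_preLie, countDots_graftRoot, map_add, counitHom_preLie, map_mul, counitHom_dot,
    zero_mul, add_zero, zero_smul]

/-- The element whose image under `graftRoot` is `δ_{n+1}`. -/
def deltaChildren : ℕ → ConnesKreimer K
  | 0 => 1
  | n + 1 => preLie K (deltaChildren n) (tree K RTree.dot) + tree K RTree.dot * deltaChildren n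

theorem delta_eq_graftRoot (n : ℕ) : delta K (n + 1) = graftRoot K (deltaChildren n) := by
  induction n with
  | zero => exact graftRoot_one.symm
  | succ n ih => rw [delta_add_two, ih, graftRoot_preLie, deltaChildren]

theorem countDots_deltaChildren (n : ℕ) :
    countDots (deltaChildren n : ConnesKreimer K) = Polynomial.X ^ n := by
  induction n with
  | zero => simp [deltaChildren]
  | succ n ih =>
    rw [deltaChildren, map_add, countDots_preLie_dot, map_mul, countDots_dot, ih, zero_add,
      pow_succ']

/-- The linear map that sends `X ^ n` to the variable `X_n`. -/
def powToVar : Polynomial K →ₗ[K] MvPolynomial ℕ K :=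
  (Polynomial.basisMonomials K).constr K MvPolynomial.X

theorem powToVar_X_pow (n : ℕ) : powToVar (Polynomial.X ^ n : Polynomial K) = MvPolynomial.X n := by
  rw [Polynomial.X_pow_eq_monomial, ← congrFun (Polynomial.coe_basisMonomials K) n]
  exact (Polynomial.basisMonomials K).constr_basis K _ n

/-- The algebra morphism that sends the corolla with `n` leaves to the variable `X_n`, and the other
trees to `0`. -/
def corollaVar : ConnesKreimer K →ₐ[K] MvPolynomial ℕ K :=
  liftGraft (powToVar ∘ₗ countDots.toLinearMap)

theorem corollaVar_delta (n : ℕ) : corollaVar (delta K (n + 1)) = MvPolynomial.X n := by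
  rw [delta_eq_graftRoot, corollaVar, liftGraft_graftRoot]
  exact (congrArg powToVar (countDots_deltaChildren n)).trans (powToVar_X_pow n)

theorem algebraicIndependent_delta : AlgebraicIndependent K fun n => delta K (n + 1) := by
  refine .of_comp corollaVar ?_
  simpa only [Function.comp_def, corollaVar_delta] using MvPolynomial.algebraicIndependent_X ℕ K

/-! ### The antipode of `δ_n` as a polynomial -/

open MvPolynomial

variable (K) in
/-- The algebra morphism that sends the variable `X_n` to `δ_{n+1}`. -/
def evalDelta : MvPolynomial ℕ K →ₐ[K] ConnesKreimer K := aeval fun n => delta K (n + 1)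

theorem evalDelta_X (n : ℕ) : evalDelta K (X n) = delta K (n + 1) := aeval_X _ n

theorem evalDelta_injective : Function.Injective (evalDelta K) := algebraicIndependent_delta

variable (K) in
/-- The derivation that sends each variable to the next one. On polynomials in the `δ_n`, it is the
grafting of `δ_1`. -/
def shiftDer : Derivation K (MvPolynomial ℕ K) (MvPolynomial ℕ K) :=
  mkDerivation K fun n => X (n + 1)

theorem evalDelta_shiftDer (p : MvPolynomial ℕ K) :
    evalDelta K (shiftDer K p) = preLie K (evalDelta K p) (tree K RTree.dot) := by
  induction p using MvPolynomial.induction_on with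
  | C a =>
    rw [← algebraMap_eq, Derivation.map_algebraMap, AlgHom.commutes, map_zero]
    exact (derivationsAlong.map_algebraMap (preLie_flip_mem_derivationsAlong _) a).symm
  | add p q hp hq => simp only [map_add, LinearMap.add_apply, hp, hq]
  | mul_X p n hp =>
    rw [Derivation.leibniz, smul_eq_mul, smul_eq_mul, map_add, map_mul, map_mul, map_mul, hp,
      shiftDer, mkDerivation_X, evalDelta_X, evalDelta_X, delta_add_two, mul_preLie]

theorem coeff_shiftDer (p : MvPolynomial ℕ K) {m : ℕ →₀ ℕ} {N : ℕ} (hm : ∀ j, N < j → m j = 0) :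
    (shiftDer K p).coeff m = ∑ k ∈ Finset.range N, if 1 ≤ m (k + 1) then
      (m k + 1 : K) * p.coeff (m - Finsupp.single (k + 1) 1 + Finsupp.single k 1) else 0 := by
  classical
  have coeff_term (k : ℕ) : (pderiv k p • X (k + 1) : MvPolynomial ℕ K).coeff m =
      if 1 ≤ m (k + 1) then
        (m k + 1 : K) * p.coeff (m - Finsupp.single (k + 1) 1 + Finsupp.single k 1) else 0 := by
    rw [smul_eq_mul, coeff_mul_X', coeff_pderiv]
    simp [Nat.one_le_iff_ne_zero, mul_comm]
  rw [shiftDer, mkDerivation_eq_sum_pderiv _ (Finset.subset_union_left (s₂ := Finset.range N)),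
    coeff_sum]
  simp only [coeff_term]
  refine (Finset.sum_subset Finset.subset_union_right fun k _ hk => if_neg ?_).symm
  rw [hm (k + 1) (by rw [Finset.mem_range] at hk; omega)]
  exact Nat.not_succ_le_zero 0

variable (K) in
/-- The polynomial that expresses the antipode of `δ_{n+1}`. -/
def antipodePoly : ℕ → MvPolynomial ℕ K
  | 0 => -X 0
  | n + 1 => shiftDer K (antipodePoly n) - C ((n + 1 : ℕ) : K) * (X 0 * antipodePoly n)

theorem antipode_delta (n : ℕ) :
    antipode K (delta K (n + 1)) = evalDelta K (antipodePoly K n) := by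
  induction n with
  | zero => exact antipode_dot.trans (by rw [antipodePoly, map_neg, evalDelta_X]; rfl)
  | succ n ih =>
    rw [antipode_delta_add_two, ih, antipodePoly, map_sub, evalDelta_shiftDer, C_mul', map_smul,
      map_mul, evalDelta_X, Nat.cast_smul_eq_nsmul]
    rfl

theorem coeff_antipodePoly_succ (n : ℕ) {m : ℕ →₀ ℕ} {N : ℕ} (hm : ∀ j, N < j → m j = 0) :
    (antipodePoly K (n + 1)).coeff m =
      (∑ k ∈ Finset.range N, if 1 ≤ m (k + 1) then (m k + 1 : K) *
        (antipodePoly K n).coeff (m - Finsupp.single (k + 1) 1 + Finsupp.single k 1) else 0) -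
      ((n + 1 : ℕ) : K) *
        if 1 ≤ m 0 then (antipodePoly K n).coeff (m - Finsupp.single 0 1) else 0 := by
  rw [antipodePoly, coeff_sub, coeff_shiftDer _ hm, coeff_C_mul, coeff_X_mul']
  simp only [Finsupp.mem_support_iff, Nat.one_le_iff_ne_zero]

theorem coeff_antipodePoly_single (n : ℕ) :
    (antipodePoly K n).coeff (Finsupp.single n 1) = -1 := by
  classical
  induction n with
  | zero => simp [antipodePoly]
  | succ n ih =>
    rw [coeff_antipodePoly_succ n (N := n + 1) fun j hj => Finsupp.single_eq_of_ne (by omega),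
      Finset.sum_eq_single_of_mem n (by simp)]
    · simp [ih]
    · intro k _ hk
      simp [Ne.symm hk]

/-- The weight `1 m_0 + 2 m_1 + ⋯` of an exponent, so that `X_n` has the degree of `δ_{n+1}`. -/
abbrev deltaWeight : (ℕ →₀ ℕ) →+ ℕ := Finsupp.weight fun k => k + 1

theorem isWeightedHomogeneous_antipodePoly (n : ℕ) :
    IsWeightedHomogeneous (fun k => k + 1) (antipodePoly K n) (n + 1) := by
  have hX (k : ℕ) : IsWeightedHomogeneous (fun k => k + 1) (X k : MvPolynomial ℕ K) (k + 1) :=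
    isWeightedHomogeneous_X K _ k
  induction n with
  | zero => exact (hX 0).neg
  | succ n ih =>
    refine (isWeightedHomogeneous_mkDerivation (fun k => hX (k + 1)) ih).sub ?_
    rw [add_comm]
    exact ((hX 0).mul ih).C_mul _

theorem deltaWeight_shift {m : ℕ →₀ ℕ} {k : ℕ} (hk : 1 ≤ m (k + 1)) :
    deltaWeight (m - Finsupp.single (k + 1) 1 + Finsupp.single k 1) + 1 = deltaWeight m := by
  rw [← Finsupp.weight_sub_single_add (Nat.one_le_iff_ne_zero.1 hk), map_add,
    Finsupp.weight_single, one_smul]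
  ring

theorem eq_zero_of_deltaWeight_le {m : ℕ →₀ ℕ} {j : ℕ} (h : deltaWeight m ≤ j) : m j = 0 := by
  by_contra hj
  exact absurd (Finsupp.le_weight_of_ne_zero' (fun k => k + 1) hj) (by simpa using h)

theorem eq_single_of_deltaWeight {m : ℕ →₀ ℕ} {n : ℕ} (hm : deltaWeight m = n + 1)
    (hn : m n ≠ 0) : m = Finsupp.single n 1 := by
  have hw : deltaWeight (m - Finsupp.single n 1) = 0 := add_eq_right.1 <|
    (Finsupp.weight_sub_single_add (w := fun k => k + 1) hn).trans hm
  have h0 : m - Finsupp.single n 1 = 0 :=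
    Finsupp.ext fun j => eq_zero_of_deltaWeight_le (hw.trans_le (Nat.zero_le j))
  rw [← Finsupp.sub_add_single_one_cancel hn, h0, zero_add]

/-! ### From exponents to multi-indices -/

/-- A multi-index, as an exponent of the monomials in infinitely many variables. -/
def extIndex {n : ℕ} (i : Fin n → ℕ) : ℕ →₀ ℕ := ∑ k : Fin n, Finsupp.single (k : ℕ) (i k)

theorem extIndex_apply {n : ℕ} (i : Fin n → ℕ) (j : ℕ) :
    extIndex i j = if h : j < n then i ⟨j, h⟩ else 0 := by
  classical
  rw [extIndex, Finsupp.finsetSum_apply]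
  split_ifs with h
  · rw [Finset.sum_eq_single_of_mem ⟨j, h⟩ (Finset.mem_univ _), Finsupp.single_eq_same]
    exact fun k _ hk => Finsupp.single_eq_of_ne fun h' => hk (Fin.ext h'.symm)
  · exact Finset.sum_eq_zero fun k _ => Finsupp.single_eq_of_ne fun h' => h (h' ▸ k.isLt)

theorem extIndex_apply_fin {n : ℕ} (i : Fin n → ℕ) (k : Fin n) : extIndex i k = i k := by
  simp [extIndex_apply]

theorem extIndex_injective (n : ℕ) : Function.Injective (extIndex (n := n)) := fun i j h =>
  funext fun k => by rw [← extIndex_apply_fin i, h, extIndex_apply_fin]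

theorem deltaWeight_extIndex {n : ℕ} (i : Fin n → ℕ) :
    deltaWeight (extIndex i) = ∑ k : Fin n, ((k : ℕ) + 1) * i k := by
  simp [extIndex, Finsupp.weight_single, mul_comm]

theorem mem_weightedIndices_iff_deltaWeight {n : ℕ} {i : Fin n → ℕ} :
    i ∈ weightedIndices n ↔ deltaWeight (extIndex i) = n := by
  rw [mem_weightedIndices, deltaWeight_extIndex]

theorem extIndex_of_deltaWeight_le {n : ℕ} {m : ℕ →₀ ℕ} (h : deltaWeight m ≤ n) :
    extIndex (fun k : Fin n => m k) = m := by
  ext j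
  rw [extIndex_apply]
  split_ifs with hj
  · rfl
  · exact (eq_zero_of_deltaWeight_le (h.trans (not_lt.1 hj))).symm

theorem extIndex_init {n : ℕ} {i : Fin (n + 1) → ℕ} (h0 : i (Fin.last n) = 0) :
    extIndex (Fin.init i) = extIndex i := by
  rw [extIndex, extIndex, Fin.sum_univ_castSucc, h0, Finsupp.single_zero, add_zero]
  rfl

theorem extIndex_shiftIndex {n : ℕ} (i : Fin (n + 1) → ℕ) (k : Fin n) :
    extIndex (shiftIndex i k.succ) =
      extIndex i - Finsupp.single ((k : ℕ) + 1) 1 + Finsupp.single (k : ℕ) 1 := by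
  ext j
  simp only [Finsupp.add_apply, Finsupp.tsub_apply, extIndex_apply, shiftIndex,
    Finsupp.single_apply, Fin.ext_iff, Fin.val_succ]
  have hk := k.isLt
  split_ifs <;> omega

theorem extIndex_decrFirst {n : ℕ} (i : Fin n → ℕ) :
    extIndex (decrFirst i) = extIndex i - Finsupp.single 0 1 := by
  ext j
  simp only [Finsupp.tsub_apply, extIndex_apply, decrFirst, Finsupp.single_apply]
  split_ifs <;> omega

/-- The polynomial with prescribed coefficients at the multi-indices of weight `n`. -/
def weightedPoly (n : ℕ) (b : (Fin n → ℕ) → K) : MvPolynomial ℕ K :=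
  ∑ i ∈ weightedIndices n, monomial (extIndex i) (b i)

theorem evalDelta_weightedPoly (n : ℕ) (b : (Fin n → ℕ) → K) :
    evalDelta K (weightedPoly n b) =
      ∑ i ∈ weightedIndices n, b i • ∏ k : Fin n, delta K ((k : ℕ) + 1) ^ i k := by
  rw [weightedPoly, map_sum]
  refine Finset.sum_congr rfl fun i _ => ?_
  rw [evalDelta, aeval_monomial, extIndex, ← Finsupp.prod_finsetSum_index
    (fun _ => pow_zero _) (fun _ _ _ => pow_add _ _ _), Algebra.smul_def]
  simp only [pow_zero, Finsupp.prod_single_index]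

theorem coeff_weightedPoly {n : ℕ} (b : (Fin n → ℕ) → K) {i : Fin n → ℕ}
    (hi : i ∈ weightedIndices n) : (weightedPoly n b).coeff (extIndex i) = b i := by
  classical
  rw [weightedPoly, coeff_sum, Finset.sum_eq_single_of_mem i hi]
  · rw [coeff_monomial, if_pos rfl]
  · intro j _ hj
    rw [coeff_monomial, if_neg fun h => hj (extIndex_injective n h)]

theorem isWeightedHomogeneous_weightedPoly (n : ℕ) (b : (Fin n → ℕ) → K) :
    IsWeightedHomogeneous (fun k => k + 1) (weightedPoly n b) n :=
  .sum _ _ _ fun _ hi =>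
    isWeightedHomogeneous_monomial _ _ _ (mem_weightedIndices_iff_deltaWeight.1 hi)

theorem weightedPoly_coeff {n : ℕ} {p : MvPolynomial ℕ K}
    (hp : IsWeightedHomogeneous (fun k => k + 1) p n) :
    weightedPoly n (fun i => p.coeff (extIndex i)) = p := by
  ext m
  by_cases hm : deltaWeight m = n
  · have hext := extIndex_of_deltaWeight_le hm.le
    rw [← hext, coeff_weightedPoly]
    rw [mem_weightedIndices_iff_deltaWeight, hext, hm]
  · rw [hp.coeff_eq_zero m hm, (isWeightedHomogeneous_weightedPoly n _).coeff_eq_zero m hm]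

theorem isAntipodeExpansion_iff (a : (n : ℕ) → (Fin n → ℕ) → K) :
    IsAntipodeExpansion K a ↔ ∀ n, weightedPoly (n + 1) (a (n + 1)) = antipodePoly K n := by
  have h (n : ℕ) : antipode K (delta K (n + 1)) =
      ∑ i ∈ weightedIndices (n + 1), a (n + 1) i •
        ∏ k : Fin (n + 1), delta K ((k : ℕ) + 1) ^ i k ↔
      weightedPoly (n + 1) (a (n + 1)) = antipodePoly K n := by
    rw [← evalDelta_weightedPoly, antipode_delta, evalDelta_injective.eq_iff, eq_comm]
  refine ⟨fun ha n => (h n).1 (ha (n + 1) n.succ_pos), fun ha n hn => ?_⟩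
  obtain ⟨n, rfl⟩ := Nat.exists_eq_add_of_le' hn
  exact (h n).2 (ha n)

theorem exists_isAntipodeExpansion : ∃ a : (n : ℕ) → (Fin n → ℕ) → K, IsAntipodeExpansion K a :=
  ⟨fun n i => (antipodePoly K (n - 1)).coeff (extIndex i), (isAntipodeExpansion_iff _).2 fun n =>
    weightedPoly_coeff (isWeightedHomogeneous_antipodePoly n)⟩

end

end ConnesKreimer

namespace IsAntipodeExpansion

open ConnesKreimer

variable {K : Type*} [CommRing K] {a : (n : ℕ) → (Fin n → ℕ) → K} (ha : IsAntipodeExpansion K a)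

include ha

theorem eq_coeff {n : ℕ} {i : Fin (n + 1) → ℕ} (hi : deltaWeight (extIndex i) = n + 1) :
    a (n + 1) i = (antipodePoly K n).coeff (extIndex i) := by
  rw [← (isAntipodeExpansion_iff a).1 ha n,
    coeff_weightedPoly _ (mem_weightedIndices_iff_deltaWeight.2 hi)]

theorem shiftIndex_eq_coeff {n : ℕ} {i : Fin (n + 1) → ℕ} (hi : deltaWeight (extIndex i) = n + 2)
    {k : Fin n} (hk : 1 ≤ extIndex i (k + 1)) :
    a (n + 1) (shiftIndex i k.succ) = (antipodePoly K n).coeff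
      (extIndex i - Finsupp.single ((k : ℕ) + 1) 1 + Finsupp.single (k : ℕ) 1) := by
  have hw := deltaWeight_shift hk
  rw [hi, ← extIndex_shiftIndex] at hw
  rw [ha.eq_coeff (by omega), extIndex_shiftIndex]

theorem decrFirst_eq_coeff {n : ℕ} {i : Fin (n + 1) → ℕ} (hi : deltaWeight (extIndex i) = n + 2)
    (h0 : 1 ≤ extIndex i 0) :
    a (n + 1) (decrFirst i) = (antipodePoly K n).coeff (extIndex i - Finsupp.single 0 1) := by
  have hw : deltaWeight (extIndex (decrFirst i)) + 1 = n + 2 := by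
    rw [extIndex_decrFirst, ← hi]
    exact Finsupp.weight_sub_single_add (Nat.one_le_iff_ne_zero.1 h0)
  rw [ha.eq_coeff (by omega), extIndex_decrFirst]

theorem recursion {n : ℕ} {i : Fin (n + 2) → ℕ} (hi : deltaWeight (extIndex i) = n + 2)
    (h0 : i (Fin.last (n + 1)) = 0) :
    a (n + 2) i =
      (∑ j ∈ Finset.univ.filter fun j : Fin (n + 1) => 1 ≤ (j : ℕ) ∧ 1 ≤ Fin.init i j,
        ((Fin.init i (predPosition j) : ℕ) + 1 : K) * a (n + 1) (shiftIndex (Fin.init i) j))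
      - ((n + 1 : ℕ) : K) * (if 1 ≤ i 0 then a (n + 1) (decrFirst (Fin.init i)) else 0) := by
  rw [ha.eq_coeff hi]
  rw [← extIndex_init h0] at hi ⊢
  change _ = _ - _ * if 1 ≤ Fin.init i 0 then _ else _
  generalize Fin.init i = i at hi ⊢
  have hm (j : ℕ) (hj : n < j) : extIndex i j = 0 := by
    rw [extIndex_apply, dif_neg (by omega)]
  rw [coeff_antipodePoly_succ n hm, Finset.sum_range, Finset.sum_filter, Fin.sum_univ_succ,
    if_neg (c := 1 ≤ ((0 : Fin (n + 1)) : ℕ) ∧ _) (by simp), zero_add]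
  congr 1
  · refine Finset.sum_congr rfl fun k _ => ?_
    have hsucc : extIndex i (k + 1) = i k.succ := extIndex_apply_fin i k.succ
    have hpred : extIndex i k = i (predPosition k.succ) := extIndex_apply_fin i k.castSucc
    simp only [hsucc, hpred, Fin.val_succ, Nat.le_add_left, true_and]
    split_ifs with hk
    · rw [ha.shiftIndex_eq_coeff hi (hk.trans_eq hsucc.symm)]
    · rfl
  · have hzero : extIndex i 0 = i 0 := extIndex_apply_fin i 0
    rw [hzero]
    split_ifs with hk
    · rw [ha.decrFirst_eq_coeff hi (hk.trans_eq hzero.symm)]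
    · rfl

end IsAntipodeExpansion

theorem proposition2p1_general (K : Type*) [CommRing K] :
    (∃ a : (n : ℕ) → (Fin n → ℕ) → K, IsAntipodeExpansion K a) ∧
    ∀ a : (n : ℕ) → (Fin n → ℕ) → K, IsAntipodeExpansion K a →
      ∀ (n : ℕ) (i : Fin (n + 1) → ℕ), ∑ k : Fin (n + 1), ((k : ℕ) + 1) * i k = n + 1 →
        (i (Fin.last n) = 1 →
          (∀ k : Fin (n + 1), k ≠ Fin.last n → i k = 0) ∧ a (n + 1) i = -1) ∧
        (i (Fin.last n) ≠ 1 →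
          i (Fin.last n) = 0 ∧
          a (n + 1) i =
            (∑ j ∈ Finset.univ.filter fun j : Fin n => 1 ≤ (j : ℕ) ∧ 1 ≤ Fin.init i j,
              ((Fin.init i (predPosition j) : ℕ) + 1 : K) * a n (shiftIndex (Fin.init i) j))
            - (n : K) * (if 1 ≤ i 0 then a n (decrFirst (Fin.init i)) else 0)) := by
  refine ⟨ConnesKreimer.exists_isAntipodeExpansion, fun a ha n i hi => ?_⟩
  have weight_eq := (ConnesKreimer.deltaWeight_extIndex i).trans hi
  have last_eq := ConnesKreimer.extIndex_apply_fin i (Fin.last n)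
  have eq_single (h : i (Fin.last n) ≠ 0) : ConnesKreimer.extIndex i = Finsupp.single n 1 :=
    ConnesKreimer.eq_single_of_deltaWeight weight_eq (last_eq.trans_ne h)
  refine ⟨fun h1 => ⟨fun k hk => ?_, ?_⟩, fun h1 => ?_⟩
  · rw [← ConnesKreimer.extIndex_apply_fin i k, eq_single (h1.trans_ne one_ne_zero)]
    exact Finsupp.single_eq_of_ne (Fin.val_ne_of_ne hk)
  · rw [ha.eq_coeff weight_eq, eq_single (h1.trans_ne one_ne_zero),
      ConnesKreimer.coeff_antipodePoly_single]
  · have last_eq_zero : i (Fin.last n) = 0 := by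
      by_contra h
      exact h1 (by rw [← last_eq, eq_single h, Fin.val_last, Finsupp.single_eq_same])
    refine ⟨last_eq_zero, ?_⟩
    cases n with
    | zero => simp [show i 0 = 0 from last_eq_zero] at hi
    | succ n => exact ha.recursion weight_eq last_eq_zero

theorem proposition2p1 (K : Type*) [Field K] [CharZero K] :
    -- `S(δ_n)` can be expanded as a polynomial in `δ_1, …, δ_n`
    (∃ a : (n : ℕ) → (Fin n → ℕ) → K, IsAntipodeExpansion K a) ∧
    -- and the coefficients satisfy the recursion; below, the length of the multi-index
    -- `i = (i_1, …, i_{n+1})` is `n + 1`, and `Fin.init i` is `(i_1, …, i_n)`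
    ∀ a : (n : ℕ) → (Fin n → ℕ) → K, IsAntipodeExpansion K a →
      ∀ (n : ℕ) (i : Fin (n + 1) → ℕ), ∑ k : Fin (n + 1), ((k : ℕ) + 1) * i k = n + 1 →
        (i (Fin.last n) = 1 →
          (∀ k : Fin (n + 1), k ≠ Fin.last n → i k = 0) ∧ a (n + 1) i = -1) ∧
        (i (Fin.last n) ≠ 1 →
          i (Fin.last n) = 0 ∧
          a (n + 1) i =
            (∑ j ∈ Finset.univ.filter fun j : Fin n => 1 ≤ (j : ℕ) ∧ 1 ≤ Fin.init i j,
              ((Fin.init i (predPosition j) : ℕ) + 1 : K) * a n (shiftIndex (Fin.init i) j))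
            - (n : K) * (if 1 ≤ i 0 then a n (decrFirst (Fin.init i)) else 0)) :=
  proposition2p1_general K
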